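/- **Notation.** For nonzero integers $s_1,\dots,s_r$ and $n\ge 0$ put $$\zeta_n(s_1,\dots,s_r)=\sum_{n\ge k_1>\cdots>k_r\ge 1}\ \prod_{j=1}^r\frac{\sigma_j^{k_j}}{k_j^{|s_j|}},\qquad \sigma_j=\begin{cases}-1,&s_j<0\\ 1,&s_j>0,\end{cases}$$ and write $\bar p$ for the argument $-p$ ($p\ge 1$). Put $\zeta(s_1,\dots,s_r)=\lim_{n\to\infty}\zeta_n(s_1,\dots,s_r)$ when the limit exists, and, for positive $s_j$, $$\zeta(s_1,\dots,s_r;x)=\mathrm{Li}_{s_1,\dots,s_r}(x)=\sum_{k_1>\cdots>k_r\ge 1}\frac{x^{k_1}}{k_1^{s_1}\cdots k_r^{s_r}}.$$ $\{1\}_a$ denotes $a$ repetitions of the argument $1$. For integers $k\ge 1$, $m\ge 0$ let $$J(k,m)=\int_0^1\frac{\ln^k(1-t)\,\ln^m(1+t)}{1+t}\,dt .$$ **Theorem 2.2.** The integrals $J(k,m)$ ($k\ge1$, $m\ge0$), the limits defining $\zeta(\bar 1,\{1\}_a,\bar 1,\{1\}_b)$ ($a,b\ge0$) and $\zeta(p,\{1\}_a)$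 ($p\ge2$, $a\ge0$), and the series $\zeta(p,\{1\}_a;\tfrac12)$ ($p\ge1$, $a\ge0$) converge, and the following hold. For all integers $m,k\ge 1$, $$\zeta(\bar 1,\{1\}_{m-1},\bar 1,\{1\}_{k-1})=\frac{(-1)^{k-1}}{k!\,(m-1)!}J(k,m-1)-\sum_{i=1}^{m-1}\frac{(\ln 2)^i}{i!}\,\zeta(\bar 1,\{1\}_{m-1-i},\bar 1,\{1\}_{k-1}).\tag{2.3}$$ For all integers $k\ge1$ and $m\ge 0$, $$\begin{aligned}J(k,m)={}&\frac{(\ln 2)^{m+k+1}}{m+1}+\sum_{i=1}^k\sum_{j=0}^m(-1)^{i+j}i!\,j!\,(\ln 2)^{m+k-i-j}\binom ki\binom mj\,\zeta(j+2,\{1\}_{i-1})\\&-\sum_{i=1}^k\sum_{j=0}^m\sum_{l=0}^j(-1)^{i+j}i!\,l!\,(\ln 2)^{m+k-i-l}\binom ki\binom mj\binom jl\,\zeta\!\left(l+2,\{1\}_{i-1};\tfrac12\right)\end{aligned}\tag{2.4}$$ and $$J(k,m)=\sum_{i=0}^k\sum_{j=0}^m\sum_{l=0}^i(-1)^{i+j}j!\,l!\,(\ln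 2)^{m+k-j-l}\binom ki\binom il\binom mj\,\zeta\!\left(l+1,\{1\}_j;\tfrac12\right).\tag{2.5}$$ -/

import Mathlib

open Filter Topology

noncomputable section

/-- The factor `σ ^ k / k ^ |s|` attached to the summation variable `k` by the argument `s`, where
`σ = -1` if `s` is negative and `σ = 1` otherwise. A negative integer `s = -p` encodes the barred
argument `p̄`, a positive one the unbarred argument. -/
def mzvFactor (s : ℤ) (k : ℕ) : ℝ :=
  (if s < 0 then (-1 : ℝ) ^ k else 1) / (k : ℝ) ^ s.natAbs

/-- The (alternating) multiple harmonic number `ζ_n(s₁, …, s_r)`: the sum over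
`n ≥ k₁ > k₂ > ⋯ > k_r ≥ 1` of the product of the factors of the `k_j`, written by summing over
the outermost variable `k₁` first. The empty list gives `1`. -/
def multHarmonic : List ℤ → ℕ → ℝ
  | [], _ => 1
  | s :: S, n => ∑ k ∈ Finset.Icc 1 n, mzvFactor s k * multHarmonic S (k - 1)

/-- The (alternating) multiple zeta value `ζ(s₁, …, s_r) = lim_{n → ∞} ζ_n(s₁, …, s_r)`. -/
def mzv (S : List ℤ) : ℝ := limUnder atTop (multHarmonic S)

/-- Partial sums of the multiple polylogarithm: the sum over `n ≥ k₁ > ⋯ > k_r ≥ 1` of `x ^ k₁`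
times the product of the factors of the `k_j`. -/
def multPolylogPartial (x : ℝ) : List ℤ → ℕ → ℝ
  | [], _ => 1
  | s :: S, n => ∑ k ∈ Finset.Icc 1 n, x ^ k * (mzvFactor s k * multHarmonic S (k - 1))

/-- The multiple polylogarithm `ζ(s₁, …, s_r; x) = Li_{s₁, …, s_r}(x)`. -/
def multPolylog (S : List ℤ) (x : ℝ) : ℝ := limUnder atTop (multPolylogPartial x S)

/-- The argument string `(1̄, {1}_a, 1̄, {1}_b)`. -/
def barOneBarOne (a b : ℕ) : List ℤ :=
  (-1) :: (List.replicate a 1 ++ (-1) :: List.replicate b 1)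

/-- The argument string `(p, {1}_a)`. -/
def consOnes (p a : ℕ) : List ℤ := (p : ℤ) :: List.replicate a 1

/-- The integrand `ln^k(1-t) ln^m(1+t) / (1+t)`. -/
def logIntegrand (k m : ℕ) (t : ℝ) : ℝ :=
  Real.log (1 - t) ^ k * Real.log (1 + t) ^ m / (1 + t)

/-- `J(k, m) = ∫_0^1 ln^k(1-t) ln^m(1+t) / (1+t) dt`. -/
def logIntegral (k m : ℕ) : ℝ := ∫ t in (0 : ℝ)..1, logIntegrand k m t

end

/-! Multiple polylogarithms are handled as power series with coefficients bounded through |ζ_n(S)| =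
O(√n). Differentiation strips the leading argument: Li_{p+1,S}' = Li_{p,S}/x and Li_{1,s,S}' =
Li_{s,S}/(1-x). Hence Li of b+1 ones is (-log(1-x))^(b+1)/(b+1)! (`polylogSeries_one_replicate`),
and every formula becomes the fundamental theorem of calculus for an explicit primitive, with Abel's
theorem supplying the value at 1.

Recurrence: let G_a be the power series whose limit at 1 is ζ(1̄,{1}_a,1̄,{1}_b). Then G_{a+1}' =
-G_a/(1+y), so the derivative of Σ log(1+y)^i/i! · G_{M-i} telescopes to a multiple of the integrand
of J(b+1,M). Integrating over (0,1) gives `sum_log_two_pow_mul_mzv_barOneBarOne`.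

Evaluations: t = 1-2u turns J into an integral over (0,1/2) of powers of log u + log 2 and log(1-u)
+ log 2, divided by 1-u. The binomial theorem leaves integrals of log^i u · log^j(1-u)/(1-u), whose
primitives come from repeated integration by parts (`logPrimitive`). On (0,1/2) only values at 1/2
survive; after the reflection to (1/2,1) the endpoint 1 contributes zeta values as well. -/

noncomputable section

/-! ### Coefficients and their size -/

/-- The coefficient of `x ^ n` in the multiple polylogarithm with arguments `s :: S`. -/
def polylogCoeff (s : ℤ) (S : List ℤ) (n : ℕ) : ℝ := mzvFactor s n * multHarmonic S (n - 1)

/-- The multiple polylogarithm with arguments `s :: S` as a power series. -/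
def polylogSeries (s : ℤ) (S : List ℤ) (x : ℝ) : ℝ := ∑' n, polylogCoeff s S n * x ^ n

/-- Division by `0 ^ s.natAbs = 0` yields 0 by convention, so sums over k ≥ 1 may start at k = 0 and
be read as power series. -/
lemma mzvFactor_zero {s : ℤ} (hs : s ≠ 0) : mzvFactor s 0 = 0 := by
  simp [mzvFactor, Int.natAbs_eq_zero, hs]

lemma polylogCoeff_zero {s : ℤ} (hs : s ≠ 0) (S : List ℤ) : polylogCoeff s S 0 = 0 := by
  simp [polylogCoeff, mzvFactor_zero hs]

lemma abs_mzvFactor (s : ℤ) (n : ℕ) : |mzvFactor s n| = 1 / (n : ℝ) ^ s.natAbs := by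
  unfold mzvFactor
  split_ifs <;> simp [abs_div]

lemma abs_mzvFactor_le {s : ℤ} {p n : ℕ} (hs : p ≤ s.natAbs) (hn : 1 ≤ n) :
    |mzvFactor s n| ≤ 1 / (n : ℝ) ^ p := by
  rw [abs_mzvFactor]
  have h1 : (1 : ℝ) ≤ n := by exact_mod_cast hn
  exact one_div_le_one_div_of_le (by positivity) (pow_le_pow_right₀ h1 hs)

lemma sum_range_succ_eq_add_sum_Icc (f : ℕ → ℝ) (n : ℕ) :
    ∑ k ∈ Finset.range (n + 1), f k = f 0 + ∑ k ∈ Finset.Icc 1 n, f k := by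
  induction n with
  | zero => simp
  | succ n ih => rw [Finset.sum_range_succ, ih, Finset.sum_Icc_succ_top (by omega), add_assoc]

lemma multHarmonic_cons_succ (s : ℤ) (S : List ℤ) (n : ℕ) :
    multHarmonic (s :: S) (n + 1) =
      multHarmonic (s :: S) n + mzvFactor s (n + 1) * multHarmonic S n := by
  simp only [multHarmonic]
  rw [Finset.sum_Icc_succ_top (by omega)]
  simp

lemma multHarmonic_cons_zero (s : ℤ) (S : List ℤ) : multHarmonic (s :: S) 0 = 0 := by
  simp [multHarmonic]

/-- A crude substitute for logarithmic growth. The order √n is reproduced by one more summation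
against 1/k, at the cost of a factor 3, and is still summable against 1/n². -/
lemma abs_multHarmonic_le (S : List ℤ) (hS : ∀ s ∈ S, s ≠ 0) (n : ℕ) :
    |multHarmonic S n| ≤ 3 ^ S.length * √((n : ℝ) + 1) := by
  induction S generalizing n with
  | nil =>
    simp only [multHarmonic, abs_one, List.length_nil, pow_zero, one_mul]
    exact Real.one_le_sqrt.2 (by linarith [n.cast_nonneg (α := ℝ)])
  | cons s S ih =>
    have hs : s ≠ 0 := hS s (by simp)
    have hS' : ∀ t ∈ S, t ≠ 0 := fun t ht => hS t (by simp [ht])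
    induction n with
    | zero => rw [multHarmonic_cons_zero]; simp
    | succ n ihn =>
      rw [multHarmonic_cons_succ]
      have hf : |mzvFactor s (n + 1)| ≤ 1 / ((n : ℝ) + 1) := by
        have := abs_mzvFactor_le (s := s) (p := 1) (n := n + 1) (by omega) (by omega)
        simpa using this
      have hn : (0 : ℝ) ≤ n := n.cast_nonneg
      set a := √((n : ℝ) + 1) with ha
      set b := √((n : ℝ) + 1 + 1) with hb
      have ha1 : 1 ≤ a := Real.one_le_sqrt.2 (by linarith)
      have ha2 : a ^ 2 = n + 1 := Real.sq_sqrt (by linarith)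
      have hb2 : b ^ 2 = n + 1 + 1 := Real.sq_sqrt (by linarith)
      have hb0 : 0 ≤ b := Real.sqrt_nonneg _
      have hb3 : b ≤ 2 * a := by nlinarith
      -- Here (b - a)(b + a) = 1 and b + a ≤ 3a, so the increment 1/a is at most 3(b - a), which
      -- telescopes in n.
      have hstep : 1 / ((n : ℝ) + 1) * a ≤ 3 * (b - a) := by
        rw [← ha2, one_div_mul_eq_div, div_le_iff₀ (by positivity)]
        have h1 : (b - a) * (b + a) = 1 := by nlinarith
        have h2 : 0 ≤ b - a := by nlinarith
        nlinarith [mul_le_mul_of_nonneg_left hb3 h2, mul_nonneg h2 (by linarith : 0 ≤ a)]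
      have hprod : |mzvFactor s (n + 1) * multHarmonic S n| ≤ 3 ^ S.length * (3 * (b - a)) :=
        calc |mzvFactor s (n + 1) * multHarmonic S n|
            ≤ 1 / ((n : ℝ) + 1) * (3 ^ S.length * a) := by
              rw [abs_mul]
              exact mul_le_mul hf (ih hS' n) (abs_nonneg _) (by positivity)
          _ = 3 ^ S.length * (1 / ((n : ℝ) + 1) * a) := by ring
          _ ≤ _ := by gcongr
      calc _ ≤ |multHarmonic (s :: S) n| + |mzvFactor s (n + 1) * multHarmonic S n| := abs_add_le _ _
        _ ≤ 3 ^ (s :: S).length * a + 3 ^ S.length * (3 * (b - a)) := add_le_add ihn hprod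
        _ = _ := by
          simp only [List.length_cons, pow_succ, Nat.cast_add, Nat.cast_one]
          ring

lemma abs_polylogCoeff_le {s : ℤ} {S : List ℤ} {p n : ℕ} (hS : ∀ t ∈ S, t ≠ 0)
    (hp : p ≤ s.natAbs) (hn : 1 ≤ n) :
    |polylogCoeff s S n| ≤ 3 ^ S.length * (√n / (n : ℝ) ^ p) := by
  obtain ⟨m, rfl⟩ : ∃ m, n = m + 1 := ⟨n - 1, by omega⟩
  rw [polylogCoeff, abs_mul, Nat.add_sub_cancel]
  have h := abs_multHarmonic_le S hS m
  calc _ ≤ 1 / ((m + 1 : ℕ) : ℝ) ^ p * (3 ^ S.length * √((m : ℝ) + 1)) :=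
        mul_le_mul (abs_mzvFactor_le hp hn) h (abs_nonneg _) (by positivity)
    _ = _ := by push_cast; ring

lemma abs_polylogCoeff_le_const {s : ℤ} {S : List ℤ} (hs : s ≠ 0) (hS : ∀ t ∈ S, t ≠ 0) (n : ℕ) :
    |polylogCoeff s S n| ≤ 3 ^ S.length := by
  rcases Nat.eq_zero_or_pos n with rfl | hn
  · rw [polylogCoeff_zero hs]; simp
  refine (abs_polylogCoeff_le (p := 1) hS (by omega) hn).trans ?_
  have h1 : (1 : ℝ) ≤ n := by exact_mod_cast hn
  have h2 : √(n : ℝ) ≤ n := by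
    rw [Real.sqrt_le_left (by linarith)]; nlinarith
  have : √(n : ℝ) / (n : ℝ) ^ 1 ≤ 1 := by
    rw [pow_one]; exact div_le_one_of_le₀ h2 (by linarith)
  exact mul_le_of_le_one_right (by positivity) this

lemma summable_sqrt_div_sq : Summable fun n : ℕ => √(n : ℝ) / (n : ℝ) ^ 2 := by
  refine (Real.summable_nat_rpow.2 (by norm_num : (-3 / 2 : ℝ) < -1)).congr fun n => ?_
  rcases Nat.eq_zero_or_pos n with rfl | hn
  · norm_num [Real.zero_rpow]
  · have h : (0 : ℝ) < n := by exact_mod_cast hn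
    rw [Real.sqrt_eq_rpow, ← Real.rpow_natCast, ← Real.rpow_sub h]
    norm_num

/-! ### Convergence -/

lemma multHarmonic_cons_eq_sum_range {s : ℤ} (hs : s ≠ 0) (S : List ℤ) (n : ℕ) :
    multHarmonic (s :: S) n = ∑ k ∈ Finset.range (n + 1), polylogCoeff s S k := by
  rw [sum_range_succ_eq_add_sum_Icc, polylogCoeff_zero hs S, zero_add]
  rfl

lemma multPolylogPartial_cons_eq_sum_range {s : ℤ} (hs : s ≠ 0) (S : List ℤ) (x : ℝ) (n : ℕ) :
    multPolylogPartial x (s :: S) n =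
      ∑ k ∈ Finset.range (n + 1), polylogCoeff s S k * x ^ k := by
  rw [sum_range_succ_eq_add_sum_Icc, polylogCoeff_zero hs S, zero_mul, zero_add]
  exact Finset.sum_congr rfl fun k _ => mul_comm _ _

lemma summable_polylogCoeff {s : ℤ} {S : List ℤ} (hs : 2 ≤ s.natAbs) (hS : ∀ t ∈ S, t ≠ 0) :
    Summable (polylogCoeff s S) := by
  refine Summable.of_norm_bounded (summable_sqrt_div_sq.mul_left (3 ^ S.length)) fun n => ?_
  rw [Real.norm_eq_abs]
  rcases Nat.eq_zero_or_pos n with rfl | hn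
  · rw [polylogCoeff_zero (by omega)]; simp
  · exact abs_polylogCoeff_le hS hs hn

lemma summable_polylogCoeff_mul_pow {s : ℤ} {S : List ℤ} (hs : s ≠ 0) (hS : ∀ t ∈ S, t ≠ 0)
    {x : ℝ} (hx : |x| < 1) : Summable fun n => polylogCoeff s S n * x ^ n := by
  refine Summable.of_norm_bounded
    ((summable_geometric_of_lt_one (abs_nonneg x) hx).mul_left (3 ^ S.length)) fun n => ?_
  rw [norm_mul, norm_pow, Real.norm_eq_abs, Real.norm_eq_abs]
  gcongr
  exact abs_polylogCoeff_le_const hs hS n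

lemma tendsto_multPolylogPartial {s : ℤ} {S : List ℤ} (hs : s ≠ 0) (hS : ∀ t ∈ S, t ≠ 0)
    {x : ℝ} (hx : |x| < 1) :
    Tendsto (multPolylogPartial x (s :: S)) atTop (𝓝 (polylogSeries s S x)) := by
  have h := (summable_polylogCoeff_mul_pow hs hS hx).hasSum.tendsto_sum_nat
  refine ((tendsto_add_atTop_iff_nat 1).2 h).congr fun n => ?_
  rw [multPolylogPartial_cons_eq_sum_range hs]

lemma multPolylog_eq_polylogSeries {s : ℤ} {S : List ℤ} (hs : s ≠ 0) (hS : ∀ t ∈ S, t ≠ 0)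
    {x : ℝ} (hx : |x| < 1) : multPolylog (s :: S) x = polylogSeries s S x :=
  (tendsto_multPolylogPartial hs hS hx).limUnder_eq

lemma tendsto_multHarmonic_of_two_le {s : ℤ} {S : List ℤ} (hs : 2 ≤ s.natAbs)
    (hS : ∀ t ∈ S, t ≠ 0) : Tendsto (multHarmonic (s :: S)) atTop (𝓝 (mzv (s :: S))) := by
  refine tendsto_nhds_limUnder ⟨∑' n, polylogCoeff s S n, ?_⟩
  have h := (summable_polylogCoeff hs hS).hasSum.tendsto_sum_nat
  refine ((tendsto_add_atTop_iff_nat 1).2 h).congr fun n => ?_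
  rw [multHarmonic_cons_eq_sum_range (by omega)]

/-- An alternating series whose terms tend to zero and have bounded variation converges. -/
lemma exists_tendsto_alternating_sum {u : ℕ → ℝ} (h0 : Tendsto u atTop (𝓝 0))
    (hd : Summable fun n => u (n + 1) - u n) :
    ∃ l, Tendsto (fun n => ∑ k ∈ Finset.range n, (-1 : ℝ) ^ k * u k) atTop (𝓝 l) := by
  -- Summation by parts: the alternating sum is averaged with its shift by one index.
  have key : ∀ n, ∑ k ∈ Finset.range n, (-1 : ℝ) ^ k * u k =
      (u 0 - (-1) ^ n * u n - ∑ k ∈ Finset.range n, (-1 : ℝ) ^ k * (u (k + 1) - u k)) / 2 := by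
    intro n
    induction n with
    | zero => simp
    | succ n ih => rw [Finset.sum_range_succ, ih, Finset.sum_range_succ, pow_succ]; ring
  have hs : Summable fun k => (-1 : ℝ) ^ k * (u (k + 1) - u k) := by
    refine Summable.of_norm ?_
    simpa [norm_mul] using hd.norm
  have h1 : Tendsto (fun n => (-1 : ℝ) ^ n * u n) atTop (𝓝 0) := by
    rw [tendsto_zero_iff_norm_tendsto_zero]
    simpa [norm_mul] using h0.norm
  refine ⟨_, ((((tendsto_const_nhds (x := u 0)).sub h1).sub
    hs.hasSum.tendsto_sum_nat).div_const 2).congr fun n => (key n).symm⟩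

lemma polylogCoeff_neg_one (S : List ℤ) (n : ℕ) :
    polylogCoeff (-1) S n = (-1) ^ n * polylogCoeff 1 S n := by
  simp [polylogCoeff, mzvFactor]
  ring

lemma tendsto_sqrt_div_self : Tendsto (fun n : ℕ => √(n : ℝ) / (n : ℝ)) atTop (𝓝 0) := by
  simp_rw [Real.sqrt_div_self]
  exact (Real.tendsto_sqrt_atTop.comp tendsto_natCast_atTop_atTop).inv_tendsto_atTop

lemma tendsto_polylogCoeff_one {S : List ℤ} (hS : ∀ t ∈ S, t ≠ 0) :
    Tendsto (polylogCoeff 1 S) atTop (𝓝 0) := by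
  rw [tendsto_zero_iff_norm_tendsto_zero]
  have h := tendsto_sqrt_div_self.const_mul ((3 : ℝ) ^ S.length)
  rw [mul_zero] at h
  refine squeeze_zero' (Eventually.of_forall fun n => norm_nonneg _) ?_ h
  filter_upwards [eventually_ge_atTop 1] with n hn
  simpa using abs_polylogCoeff_le (s := 1) (p := 1) hS (by simp) hn

/-- The bounded variation needed for a leading 1̄. By the product rule for differences, the change
comes from the increment of the harmonic sum and from that of 1/n; each part is O(√n/n²). -/
lemma summable_polylogCoeff_one_diff {s : ℤ} {S : List ℤ} (hs : s ≠ 0) (hS : ∀ t ∈ S, t ≠ 0) :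
    Summable fun n => polylogCoeff 1 (s :: S) (n + 1) - polylogCoeff 1 (s :: S) n := by
  have hS' : ∀ t ∈ s :: S, t ≠ 0 := by simpa [hs] using hS
  rw [← summable_nat_add_iff 1]
  have hb : Summable fun n : ℕ => 3 ^ S.length * (√((n + 1 : ℕ) : ℝ) / ((n + 1 : ℕ) : ℝ) ^ 2) +
      3 ^ (s :: S).length * (√((n + 1 : ℕ) : ℝ) / ((n + 1 : ℕ) : ℝ) ^ 2) :=
    (((summable_nat_add_iff 1).2 summable_sqrt_div_sq).mul_left _).add
      (((summable_nat_add_iff 1).2 summable_sqrt_div_sq).mul_left _)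
  refine Summable.of_norm_bounded hb fun n => ?_
  have hn : (0 : ℝ) < n + 1 := by positivity
  have hn2 : (0 : ℝ) < n + 2 := by positivity
  have e : polylogCoeff 1 (s :: S) (n + 1 + 1) - polylogCoeff 1 (s :: S) (n + 1) =
      polylogCoeff s S (n + 1) * (1 / ((n : ℝ) + 2)) -
        polylogCoeff 1 (s :: S) (n + 1) * (1 / ((n : ℝ) + 2)) := by
    simp only [polylogCoeff, Nat.add_sub_cancel, multHarmonic_cons_succ, mzvFactor]
    norm_num
    field_simp
    ring
  rw [e, Real.norm_eq_abs]
  have h1 := abs_polylogCoeff_le (s := s) (p := 1) (n := n + 1) hS (by omega) (by omega)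
  have h2 := abs_polylogCoeff_le (s := 1) (p := 1) (n := n + 1) hS' (by simp) (by omega)
  have hle : |1 / ((n : ℝ) + 2)| ≤ 1 / ((n + 1 : ℕ) : ℝ) := by
    rw [abs_of_nonneg (by positivity)]
    push_cast
    exact one_div_le_one_div_of_le hn (by linarith)
  refine (abs_sub _ _).trans ?_
  rw [abs_mul, abs_mul]
  have e2 : ∀ c : ℝ, c * (√((n + 1 : ℕ) : ℝ) / ((n + 1 : ℕ) : ℝ) ^ 2) =
      c * (√((n + 1 : ℕ) : ℝ) / ((n + 1 : ℕ) : ℝ) ^ 1) * (1 / ((n + 1 : ℕ) : ℝ)) := by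
    intro c; field_simp
  rw [e2, e2]
  gcongr

lemma tendsto_multHarmonic_neg_one {s : ℤ} {S : List ℤ} (hs : s ≠ 0) (hS : ∀ t ∈ S, t ≠ 0) :
    Tendsto (multHarmonic (-1 :: s :: S)) atTop (𝓝 (mzv (-1 :: s :: S))) := by
  have hS' : ∀ t ∈ s :: S, t ≠ 0 := by simpa [hs] using hS
  refine tendsto_nhds_limUnder ?_
  obtain ⟨l, hl⟩ := exists_tendsto_alternating_sum (tendsto_polylogCoeff_one hS')
    (summable_polylogCoeff_one_diff hs hS)
  refine ⟨l, ((tendsto_add_atTop_iff_nat 1).2 hl).congr fun n => ?_⟩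
  rw [multHarmonic_cons_eq_sum_range (by norm_num)]
  exact Finset.sum_congr rfl fun k _ => (polylogCoeff_neg_one _ _).symm

/-- Abel's limit theorem for multiple polylogarithms. -/
lemma tendsto_polylogSeries_one {s : ℤ} {S : List ℤ} (hs : s ≠ 0)
    (h : Tendsto (multHarmonic (s :: S)) atTop (𝓝 (mzv (s :: S)))) :
    Tendsto (polylogSeries s S) (𝓝[<] 1) (𝓝 (mzv (s :: S))) := by
  refine Real.tendsto_tsum_powerSeries_nhdsWithin_lt ((tendsto_add_atTop_iff_nat 1).1 ?_)
  exact h.congr fun n => multHarmonic_cons_eq_sum_range hs S n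

/-! ### Derivatives -/

lemma hasDerivAt_polylogSeries {s : ℤ} {S : List ℤ} (hs : s ≠ 0) (hS : ∀ t ∈ S, t ≠ 0)
    {x : ℝ} (hx : |x| < 1) :
    HasDerivAt (polylogSeries s S) (∑' n, polylogCoeff s S n * (n * x ^ (n - 1))) x := by
  obtain ⟨r, hxr, hr⟩ := exists_between hx
  have hr0 : 0 < r := (abs_nonneg x).trans_lt hxr
  have hsum : Summable fun n : ℕ => (3 : ℝ) ^ S.length * (n * r ^ (n - 1)) := by
    refine Summable.mul_left _ ?_
    have h := (summable_pow_mul_geometric_of_norm_lt_one 1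
      (r := r) (by rwa [Real.norm_of_nonneg hr0.le])).mul_left r⁻¹
    refine h.congr fun n => ?_
    rcases n with _ | n
    · simp
    · simp only [pow_succ, Nat.add_sub_cancel]; field_simp
  refine hasDerivAt_tsum_of_isPreconnected (t := Metric.ball (0 : ℝ) r) (y₀ := 0) hsum
    Metric.isOpen_ball (convex_ball _ _).isPreconnected
    (fun n y _ => (hasDerivAt_pow n y).const_mul _) (fun n y hy => ?_)
    (Metric.mem_ball_self hr0) ?_ (by simpa using hxr)
  · have hy' : |y| ≤ r := by simpa using (Metric.mem_ball.1 hy).le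
    rw [norm_mul, norm_mul, norm_pow, Real.norm_eq_abs, Real.norm_eq_abs, Real.norm_eq_abs,
      abs_of_nonneg (n.cast_nonneg (α := ℝ))]
    gcongr
    exact abs_polylogCoeff_le_const hs hS n
  · exact summable_polylogCoeff_mul_pow hs hS (by simp)

lemma polylogSeries_zero {s : ℤ} (hs : s ≠ 0) (S : List ℤ) : polylogSeries s S 0 = 0 := by
  rw [polylogSeries, tsum_eq_single 0 fun n hn => by simp [hn]]
  simp [polylogCoeff_zero hs]

lemma hasDerivAt_polylogSeries_succ {p : ℕ} (hp : 1 ≤ p) {S : List ℤ} (hS : ∀ t ∈ S, t ≠ 0)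
    {x : ℝ} (hx : |x| < 1) (hx0 : x ≠ 0) :
    HasDerivAt (polylogSeries ((p + 1 : ℕ) : ℤ) S) (polylogSeries (p : ℤ) S x / x) x := by
  convert hasDerivAt_polylogSeries (s := ((p + 1 : ℕ) : ℤ)) (by omega) hS hx using 1
  rw [polylogSeries, ← tsum_div_const]
  refine tsum_congr fun n => ?_
  rcases n with _ | n
  · rw [polylogCoeff_zero (by omega), polylogCoeff_zero (by omega)]; simp
  · have h1 : ¬ ((p : ℤ) < 0) := by omega
    have h2 : ¬ (((p + 1 : ℕ) : ℤ) < 0) := by omega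
    simp only [polylogCoeff, mzvFactor, if_neg h1, if_neg h2, Int.natAbs_natCast,
      Nat.add_sub_cancel]
    have : ((n + 1 : ℕ) : ℝ) ≠ 0 := by positivity
    field_simp
    ring

/-- Differentiation cancels the leading 1/n and leaves the generating function Σ ζ_n(s,S) xⁿ.
Multiplying it by 1 - x takes differences of consecutive ζ_n(s,S), which are the coefficients of
Li_{s,S}. -/
lemma hasDerivAt_polylogSeries_one_cons {s : ℤ} {S : List ℤ} (hs : s ≠ 0)
    (hS : ∀ t ∈ S, t ≠ 0) {x : ℝ} (hx : |x| < 1) :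
    HasDerivAt (polylogSeries 1 (s :: S)) (polylogSeries s S x / (1 - x)) x := by
  have hS' : ∀ t ∈ s :: S, t ≠ 0 := by simpa [hs] using hS
  convert hasDerivAt_polylogSeries (s := 1) one_ne_zero hS' hx using 1
  have h1x : 1 - x ≠ 0 := by linarith [(abs_lt.1 hx).2]
  rw [div_eq_iff h1x]
  have hterm : ∀ n : ℕ, polylogCoeff 1 (s :: S) (n + 1) * (((n + 1 : ℕ) : ℝ) * x ^ (n + 1 - 1)) =
      multHarmonic (s :: S) n * x ^ n := by
    intro n
    have : ((n + 1 : ℕ) : ℝ) ≠ 0 := by positivity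
    simp [polylogCoeff, mzvFactor]
    field_simp
  have hsum : Summable fun n => multHarmonic (s :: S) n * x ^ n := by
    have hb : Summable fun n : ℕ => (3 : ℝ) ^ (s :: S).length *
        ((n : ℝ) ^ 1 * |x| ^ n + |x| ^ n) :=
      ((summable_pow_mul_geometric_of_norm_lt_one 1 (r := |x|) (by simpa using hx)).add
        (summable_geometric_of_lt_one (abs_nonneg x) hx)).mul_left _
    refine Summable.of_norm_bounded hb fun n => ?_
    rw [norm_mul, norm_pow, Real.norm_eq_abs, Real.norm_eq_abs]
    have h1 := abs_multHarmonic_le (s :: S) hS' n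
    have h2 : √((n : ℝ) + 1) ≤ n + 1 := by
      have : (0 : ℝ) ≤ n := n.cast_nonneg
      rw [Real.sqrt_le_left (by linarith)]; nlinarith
    calc |multHarmonic (s :: S) n| * |x| ^ n
        ≤ 3 ^ (s :: S).length * ((n : ℝ) + 1) * |x| ^ n := by
          gcongr
          exact h1.trans (by gcongr)
      _ = _ := by ring
  have hD : ∑' n : ℕ, polylogCoeff 1 (s :: S) n * (n * x ^ (n - 1)) =
      ∑' n, multHarmonic (s :: S) n * x ^ n := by
    have hs1 : Summable fun n : ℕ => polylogCoeff 1 (s :: S) n * (n * x ^ (n - 1)) :=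
      (summable_nat_add_iff 1).1 (hsum.congr fun n => (hterm n).symm)
    rw [hs1.tsum_eq_zero_add]
    simp only [hterm]
    simp
  have hshift := (summable_nat_add_iff 1).2 hsum
  rw [hD, mul_sub, mul_one, polylogSeries,
    (summable_polylogCoeff_mul_pow hs hS hx).tsum_eq_zero_add, polylogCoeff_zero hs, zero_mul,
    zero_add, ← tsum_mul_right]
  nth_rewrite 1 [hsum.tsum_eq_zero_add]
  rw [multHarmonic_cons_zero, zero_mul, zero_add, ← hshift.tsum_sub (hsum.mul_right x)]
  refine tsum_congr fun n => ?_
  rw [multHarmonic_cons_succ, polylogCoeff, Nat.add_sub_cancel]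
  ring

lemma hasDerivAt_polylogSeries_one_nil {x : ℝ} (hx : |x| < 1) :
    HasDerivAt (polylogSeries 1 []) (1 / (1 - x)) x := by
  convert hasDerivAt_polylogSeries (s := 1) (S := []) one_ne_zero (by simp) hx using 1
  have h := summable_geometric_of_norm_lt_one (x := x) (by simpa using hx)
  have hterm : ∀ n : ℕ, polylogCoeff 1 [] (n + 1) * (((n + 1 : ℕ) : ℝ) * x ^ (n + 1 - 1)) =
      x ^ n := by
    intro n
    have : ((n + 1 : ℕ) : ℝ) ≠ 0 := by positivity
    simp [polylogCoeff, mzvFactor, multHarmonic]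
    field_simp
  have hs1 : Summable fun n : ℕ => polylogCoeff 1 [] n * (n * x ^ (n - 1)) :=
    (summable_nat_add_iff 1).1 (h.congr fun n => (hterm n).symm)
  rw [hs1.tsum_eq_zero_add]
  simp only [hterm]
  rw [tsum_geometric_of_norm_lt_one (by simpa using hx)]
  simp

lemma replicate_one_ne_zero (b : ℕ) : ∀ t ∈ List.replicate b (1 : ℤ), t ≠ 0 := by
  intro t ht
  rw [List.eq_of_mem_replicate ht]
  exact one_ne_zero

lemma hasDerivAt_neg_log_one_sub {x : ℝ} (hx : |x| < 1) :
    HasDerivAt (fun y : ℝ => -Real.log (1 - y)) (1 / (1 - x)) x := by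
  have h : (1 : ℝ) - x ≠ 0 := by linarith [(abs_lt.1 hx).2]
  convert! (((hasDerivAt_id x).const_sub 1).log h).neg using 1
  simp [neg_div]

/-- Both sides vanish at 0 and have equal derivatives on the unit ball, by induction on b. -/
lemma polylogSeries_one_replicate (b : ℕ) {x : ℝ} (hx : |x| < 1) :
    polylogSeries 1 (List.replicate b 1) x =
      (-Real.log (1 - x)) ^ (b + 1) / ((b + 1).factorial : ℝ) := by
  induction b generalizing x with
  | zero =>
    have hd : ∀ y ∈ Metric.ball (0 : ℝ) 1, |y| < 1 := fun y hy => by simpa using hy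
    have := IsOpen.eqOn_of_deriv_eq (f := polylogSeries 1 (List.replicate 0 1))
      (g := fun y : ℝ => -Real.log (1 - y)) (x := 0) Metric.isOpen_ball
      (convex_ball (0 : ℝ) 1).isPreconnected
      (fun y hy => (hasDerivAt_polylogSeries_one_nil (hd y hy)).differentiableAt.differentiableWithinAt)
      (fun y hy => (hasDerivAt_neg_log_one_sub (hd y hy)).differentiableAt.differentiableWithinAt)
      (fun y hy => (hasDerivAt_polylogSeries_one_nil (hd y hy)).deriv.trans
        (hasDerivAt_neg_log_one_sub (hd y hy)).deriv.symm)
      (Metric.mem_ball_self one_pos) (by simp [polylogSeries_zero])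
    simpa using this (by simpa using hx : x ∈ Metric.ball (0 : ℝ) 1)
  | succ b ih =>
    have hd : ∀ y ∈ Metric.ball (0 : ℝ) 1, |y| < 1 := fun y hy => by simpa using hy
    have h1 : ∀ y, |y| < 1 → HasDerivAt (polylogSeries 1 (List.replicate (b + 1) 1))
        ((-Real.log (1 - y)) ^ (b + 1) / ((b + 1).factorial : ℝ) / (1 - y)) y := by
      intro y hy
      rw [← ih hy]
      exact hasDerivAt_polylogSeries_one_cons one_ne_zero (replicate_one_ne_zero b) hy
    have h2 : ∀ y, |y| < 1 → HasDerivAt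
        (fun y => (-Real.log (1 - y)) ^ (b + 1 + 1) / ((b + 1 + 1).factorial : ℝ))
        ((-Real.log (1 - y)) ^ (b + 1) / ((b + 1).factorial : ℝ) / (1 - y)) y := by
      intro y hy
      convert! ((hasDerivAt_neg_log_one_sub hy).pow (b + 1 + 1)).div_const
        ((b + 1 + 1).factorial : ℝ) using 1
      rw [Nat.factorial_succ (b + 1)]
      have h : (1 : ℝ) - y ≠ 0 := by linarith [(abs_lt.1 hy).2]
      have : ((b + 1).factorial : ℝ) ≠ 0 := by positivity
      push_cast
      field_simp
    exact IsOpen.eqOn_of_deriv_eq Metric.isOpen_ball (convex_ball (0 : ℝ) 1).isPreconnected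
      (fun y hy => (h1 y (hd y hy)).differentiableAt.differentiableWithinAt)
      (fun y hy => (h2 y (hd y hy)).differentiableAt.differentiableWithinAt)
      (fun y hy => (h1 y (hd y hy)).deriv.trans (h2 y (hd y hy)).deriv.symm)
      (Metric.mem_ball_self one_pos) (by simp [polylogSeries_zero])
      (by simpa using hx : x ∈ Metric.ball (0 : ℝ) 1)

/-! ### Powers of the logarithm -/

lemma intervalIntegrable_log_pow (k : ℕ) :
    IntervalIntegrable (fun x => Real.log x ^ k) MeasureTheory.volume 0 1 := by
  rcases Nat.eq_zero_or_pos k with rfl | hk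
  · simp
  have hk' : (0 : ℝ) < k := by exact_mod_cast hk
  -- The k-th power of |log x| · x^(1/(2k)) ≤ 2k gives this integrable majorant.
  have hb : IntervalIntegrable (fun x : ℝ => (2 * (k : ℝ)) ^ k * x ^ (-(1 / 2) : ℝ))
      MeasureTheory.volume 0 1 :=
    (intervalIntegral.intervalIntegrable_rpow' (by norm_num)).const_mul _
  refine hb.mono_fun' (Real.measurable_log.pow_const k).aestronglyMeasurable ?_
  rw [Set.uIoc_of_le zero_le_one]
  refine (MeasureTheory.ae_restrict_iff' measurableSet_Ioc).2 (Eventually.of_forall ?_)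
  rintro x ⟨hx0, hx1⟩
  have h := (Real.abs_log_mul_self_rpow_lt x (1 / (2 * k)) hx0 hx1 (by positivity)).le
  have h2 := pow_le_pow_left₀ (abs_nonneg _) h k
  rw [abs_mul, mul_pow, abs_of_nonneg (Real.rpow_nonneg hx0.le _), ← Real.rpow_mul_natCast hx0.le,
    one_div_one_div, show 1 / (2 * (k : ℝ)) * k = 1 / 2 by field_simp] at h2
  beta_reduce
  rw [Real.rpow_neg hx0.le, norm_pow, Real.norm_eq_abs, ← div_eq_mul_inv,
    le_div_iff₀ (Real.rpow_pos_of_pos hx0 _)]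
  exact h2

lemma intervalIntegrable_log_one_sub_pow (k : ℕ) :
    IntervalIntegrable (fun x => Real.log (1 - x) ^ k) MeasureTheory.volume 0 1 := by
  simpa using ((intervalIntegrable_log_pow k).comp_sub_left 1).symm

lemma tendsto_log_pow_mul_self (k : ℕ) :
    Tendsto (fun x => Real.log x ^ k * x) (𝓝[>] 0) (𝓝 0) := by
  rcases Nat.eq_zero_or_pos k with rfl | hk
  · simpa only [pow_zero, one_mul] using! tendsto_id'.2 (nhdsWithin_le_nhds (a := (0 : ℝ)) (s := Set.Ioi 0))
  have hk' : (0 : ℝ) < k := by exact_mod_cast hk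
  have h := (tendsto_log_mul_rpow_nhdsGT_zero (r := 1 / k) (by positivity)).pow k
  rw [zero_pow hk.ne'] at h
  refine h.congr' ?_
  filter_upwards [self_mem_nhdsWithin] with x hx
  rw [mul_pow, ← Real.rpow_mul_natCast (le_of_lt hx), show 1 / (k : ℝ) * k = 1 by field_simp,
    Real.rpow_one]

/-- Since f = O(x) at 0, it beats any power of the logarithm; this removes the boundary terms of
`logPrimitive` at 0. -/
lemma tendsto_log_pow_mul_of_differentiableAt (k : ℕ) {f : ℝ → ℝ} (hf : DifferentiableAt ℝ f 0)
    (h0 : f 0 = 0) : Tendsto (fun x => Real.log x ^ k * f x) (𝓝[>] 0) (𝓝 0) := by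
  have hO : f =O[𝓝[>] 0] fun x => x := by
    simpa [h0] using hf.hasDerivAt.isBigO_sub.mono nhdsWithin_le_nhds
  exact ((Asymptotics.isBigO_refl (fun x => Real.log x ^ k) (𝓝[>] 0)).mul hO).trans_tendsto
    (tendsto_log_pow_mul_self k)

/-! ### A primitive for `log x ^ i` times a multiple polylogarithm -/

/-- If `R (l + 1)` is a primitive of `R l / x`, then this is a primitive of
`log x ^ i * (R 0)'`. -/
def logPrimitive (R : ℕ → ℝ → ℝ) (i : ℕ) (x : ℝ) : ℝ :=
  ∑ l ∈ Finset.range (i + 1), (-1) ^ l * (i.descFactorial l : ℝ) * Real.log x ^ (i - l) * R l x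

/-- One integration by parts: the remaining integrand log^i x · R 0 x / x is log^i x · (R 1)', so
the shifted family takes over. -/
lemma logPrimitive_succ (R : ℕ → ℝ → ℝ) (i : ℕ) (x : ℝ) :
    logPrimitive R (i + 1) x =
      Real.log x ^ (i + 1) * R 0 x - (i + 1) * logPrimitive (fun l => R (l + 1)) i x := by
  rw [logPrimitive, Finset.sum_range_succ', logPrimitive, Finset.mul_sum, add_comm, sub_eq_add_neg,
    ← Finset.sum_neg_distrib]
  congr 1
  · simp
  · refine Finset.sum_congr rfl fun l _ => ?_
    rw [Nat.succ_descFactorial_succ, Nat.add_sub_add_right]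
    push_cast
    ring

lemma hasDerivAt_logPrimitive {R : ℕ → ℝ → ℝ} {c x : ℝ} (hx : x ≠ 0) (h0 : HasDerivAt (R 0) c x)
    (hR : ∀ l, HasDerivAt (R (l + 1)) (R l x / x) x) (i : ℕ) :
    HasDerivAt (logPrimitive R i) (Real.log x ^ i * c) x := by
  induction i generalizing R c with
  | zero => 
    have : logPrimitive R 0 = R 0 := by funext y; simp [logPrimitive]
    simpa [this] using h0
  | succ i ih =>
    have h := (((Real.hasDerivAt_log hx).pow (i + 1)).mul h0).sub
      ((ih (R := fun l => R (l + 1)) (hR 0) fun l => hR (l + 1)).const_mul ((i : ℝ) + 1))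
    convert! h using 1
    · funext y
      exact logPrimitive_succ R i y
    · simp only [Nat.add_sub_cancel, Pi.pow_apply]
      push_cast
      field_simp
      ring

/-- As log 1 = 0, only the term l = i, which carries no logarithm, survives. -/
lemma tendsto_logPrimitive_one {R : ℕ → ℝ → ℝ} {L : ℕ → ℝ}
    (hR : ∀ l, Tendsto (R l) (𝓝[<] 1) (𝓝 (L l))) (i : ℕ) :
    Tendsto (logPrimitive R i) (𝓝[<] 1) (𝓝 ((-1) ^ i * i.factorial * L i)) := by
  have hlog : Tendsto Real.log (𝓝[<] 1) (𝓝 0) := by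
    simpa using (Real.continuousAt_log one_ne_zero).tendsto.mono_left nhdsWithin_le_nhds
  have h : Tendsto (logPrimitive R i) (𝓝[<] 1) (𝓝 (∑ l ∈ Finset.range (i + 1),
      (-1) ^ l * (i.descFactorial l : ℝ) * 0 ^ (i - l) * L l)) :=
    tendsto_finsetSum _ fun l _ => ((hlog.pow _).const_mul _).mul (hR l)
  convert h using 2
  rw [Finset.sum_eq_single i]
  · simp [Nat.descFactorial_self]
  · intro l hl hli
    have : i - l ≠ 0 := by
      have := Finset.mem_range.1 hl
      omega
    simp [this]
  · simp

lemma hasDerivAt_polylogSeries_one_replicate (b : ℕ) {x : ℝ} (hx : |x| < 1) :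
    HasDerivAt (polylogSeries 1 (List.replicate b 1))
      ((-Real.log (1 - x)) ^ b / (b.factorial : ℝ) / (1 - x)) x := by
  cases b with
  | zero => simpa using hasDerivAt_polylogSeries_one_nil hx
  | succ b =>
    rw [← polylogSeries_one_replicate b hx]
    exact hasDerivAt_polylogSeries_one_cons one_ne_zero (replicate_one_ne_zero b) hx

/-! ### Logarithmic integrals over the two halves of the unit interval -/

lemma continuousOn_log_one_sub : ContinuousOn (fun x : ℝ => Real.log (1 - x)) (Set.Iio 1) :=
  ContinuousOn.log (by fun_prop) fun x (hx : x < 1) => by linarith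

lemma intervalIntegrable_log_pow_mul_log_one_sub_pow (i j : ℕ) :
    IntervalIntegrable (fun u : ℝ => Real.log u ^ i * (Real.log (1 - u) ^ j / (1 - u)))
      MeasureTheory.volume 0 (1 / 2) := by
  refine ((intervalIntegrable_log_pow i).mono_set ?_).mul_continuousOn ?_
  · rw [Set.uIcc_of_le (by norm_num), Set.uIcc_of_le (by norm_num)]
    exact Set.Icc_subset_Icc_right (by norm_num)
  · rw [Set.uIcc_of_le (by norm_num)]
    have hlt : ∀ x ∈ Set.Icc (0 : ℝ) (1 / 2), x < 1 := fun x hx => by linarith [hx.2]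
    exact ((continuousOn_log_one_sub.mono hlt).pow j).div (by fun_prop)
      fun x hx => by linarith [hlt x hx]

lemma intervalIntegrable_log_one_sub_pow_mul_log_pow (i j : ℕ) :
    IntervalIntegrable (fun v : ℝ => Real.log (1 - v) ^ i * (Real.log v ^ j / v))
      MeasureTheory.volume (1 / 2) 1 := by
  refine ((intervalIntegrable_log_one_sub_pow i).mono_set ?_).mul_continuousOn ?_
  · rw [Set.uIcc_of_le (by norm_num), Set.uIcc_of_le (by norm_num)]
    exact Set.Icc_subset_Icc_left (by norm_num)
  · rw [Set.uIcc_of_le (by norm_num)]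
    have hne : ∀ x ∈ Set.Icc (1 / 2 : ℝ) 1, x ≠ 0 := fun x hx => by linarith [hx.1]
    exact ((continuousOn_id.log hne).pow j).div continuousOn_id hne

/-- Up to the factor (-1)^j j!, log^j(1-u)/(1-u) is the derivative of Li_{1,{1}_j}, which starts the
family. All boundary terms at 0 vanish. -/
lemma integral_log_pow_mul_log_one_sub_pow (i j : ℕ) :
    ∫ u in (0 : ℝ)..(1 / 2), Real.log u ^ i * (Real.log (1 - u) ^ j / (1 - u)) =
      (-1) ^ j * j.factorial * logPrimitive
        (fun l => polylogSeries ((l + 1 : ℕ) : ℤ) (List.replicate j 1)) i (1 / 2) := by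
  set R : ℕ → ℝ → ℝ := fun l => polylogSeries ((l + 1 : ℕ) : ℤ) (List.replicate j 1) with hRdef
  have hfac : (j.factorial : ℝ) ≠ 0 := by positivity
  have hsq : ((-1 : ℝ) ^ j) * (-1) ^ j = 1 := by rw [← mul_pow]; simp
  have hderiv : ∀ x : ℝ, 0 < x → x < 1 → HasDerivAt (logPrimitive R i)
      (Real.log x ^ i * ((-Real.log (1 - x)) ^ j / (j.factorial : ℝ) / (1 - x))) x := by
    intro x hx0 hx1
    have hx : |x| < 1 := abs_lt.2 ⟨by linarith, hx1⟩
    refine hasDerivAt_logPrimitive hx0.ne' ?_ (fun l => ?_) i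
    · simpa [hRdef] using hasDerivAt_polylogSeries_one_replicate j hx
    · exact hasDerivAt_polylogSeries_succ (by omega) (replicate_one_ne_zero j) hx hx0.ne'
  have hderiv' : ∀ x : ℝ, 0 < x → x < 1 →
      HasDerivAt (fun x => (-1) ^ j * j.factorial * logPrimitive R i x)
        (Real.log x ^ i * (Real.log (1 - x) ^ j / (1 - x))) x := by
    intro x hx0 hx1
    convert! (hderiv x hx0 hx1).const_mul ((-1 : ℝ) ^ j * j.factorial) using 1
    rw [neg_pow (Real.log (1 - x))]
    have : 1 - x ≠ 0 := by linarith
    field_simp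
    linear_combination (-(Real.log x ^ i * Real.log (1 - x) ^ j)) * hsq
  have h0 : Tendsto (fun x => (-1) ^ j * j.factorial * logPrimitive R i x) (𝓝[>] 0) (𝓝 0) := by
    have : Tendsto (logPrimitive R i) (𝓝[>] 0)
        (𝓝 (∑ l ∈ Finset.range (i + 1), (-1 : ℝ) ^ l * (i.descFactorial l : ℝ) * 0)) := by
      refine tendsto_finsetSum _ fun l _ => ?_
      simp_rw [mul_assoc (_ * _) (Real.log _ ^ _)]
      exact (tendsto_log_pow_mul_of_differentiableAt _
        (hasDerivAt_polylogSeries (by omega) (replicate_one_ne_zero j)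
          (by simp)).differentiableAt (polylogSeries_zero (by omega) _)).const_mul _
    simpa using this.const_mul ((-1 : ℝ) ^ j * j.factorial)
  have h := intervalIntegral.integral_eq_sub_of_hasDerivAt_of_tendsto (by norm_num)
    (fun x hx => hderiv' x hx.1 (by linarith [hx.2]))
    (intervalIntegrable_log_pow_mul_log_one_sub_pow i j) h0
    ((hderiv' (1 / 2) (by norm_num) (by norm_num)).continuousAt.tendsto.mono_left
      nhdsWithin_le_nhds)
  rw [h, sub_zero]

/-- The family now starts with Li_{2,{1}_b}, whose derivative is Li of b+1 ones over x. The power of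
log(1-v) is therefore at least 1; the zeroth power is treated in
`sum_choose_mul_integral_log_pow_div`. -/
lemma integral_log_one_sub_pow_mul_log_pow (b j : ℕ) :
    ∫ v in (1 / 2 : ℝ)..1, Real.log (1 - v) ^ (b + 1) * (Real.log v ^ j / v) =
      (-1) ^ (b + 1) * (b + 1).factorial * ((-1) ^ j * j.factorial * mzv (consOnes (j + 2) b) -
        logPrimitive (fun l => polylogSeries ((l + 2 : ℕ) : ℤ) (List.replicate b 1)) j (1 / 2)) := by
  set R : ℕ → ℝ → ℝ := fun l => polylogSeries ((l + 2 : ℕ) : ℤ) (List.replicate b 1) with hRdef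
  have hfac : ((b + 1).factorial : ℝ) ≠ 0 := by positivity
  have hsq : ((-1 : ℝ) ^ (b + 1)) * (-1) ^ (b + 1) = 1 := by rw [← mul_pow]; simp
  have hderiv : ∀ x : ℝ, 0 < x → x < 1 →
      HasDerivAt (fun x => (-1) ^ (b + 1) * (b + 1).factorial * logPrimitive R j x)
        (Real.log (1 - x) ^ (b + 1) * (Real.log x ^ j / x)) x := by
    intro x hx0 hx1
    have hx : |x| < 1 := abs_lt.2 ⟨by linarith, hx1⟩
    have h1 : HasDerivAt (R 0)
        ((-Real.log (1 - x)) ^ (b + 1) / ((b + 1).factorial : ℝ) / x) x := by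
      rw [← polylogSeries_one_replicate b hx]
      simpa [hRdef] using hasDerivAt_polylogSeries_succ (p := 1) le_rfl (replicate_one_ne_zero b) hx hx0.ne'
    have h := (hasDerivAt_logPrimitive hx0.ne' h1 (fun l => hasDerivAt_polylogSeries_succ
      (by omega) (replicate_one_ne_zero b) hx hx0.ne') j).const_mul
        ((-1 : ℝ) ^ (b + 1) * (b + 1).factorial)
    convert! h using 1
    rw [neg_pow (Real.log (1 - x))]
    field_simp
    linear_combination (-(Real.log x ^ j * Real.log (1 - x) ^ (b + 1))) * hsq
  have hR : ∀ l, Tendsto (R l) (𝓝[<] 1) (𝓝 (mzv (consOnes (l + 2) b))) := fun l =>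
    tendsto_polylogSeries_one (by omega)
      (tendsto_multHarmonic_of_two_le (by omega) (replicate_one_ne_zero b))
  have h := intervalIntegral.integral_eq_sub_of_hasDerivAt_of_tendsto (by norm_num)
    (fun x hx => hderiv x (by linarith [hx.1]) hx.2)
    (intervalIntegrable_log_one_sub_pow_mul_log_pow (b + 1) j)
    ((hderiv (1 / 2) (by norm_num) (by norm_num)).continuousAt.tendsto.mono_left
      nhdsWithin_le_nhds)
    ((tendsto_logPrimitive_one hR j).const_mul ((-1 : ℝ) ^ (b + 1) * (b + 1).factorial))
  rw [h, mul_sub]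

/-! ### The integral `J(k, m)` -/

lemma intervalIntegrable_logIntegrand (k m : ℕ) :
    IntervalIntegrable (logIntegrand k m) MeasureTheory.volume 0 1 := by
  have h : ContinuousOn (fun t : ℝ => Real.log (1 + t) ^ m / (1 + t)) (Set.uIcc 0 1) := by
    rw [Set.uIcc_of_le zero_le_one]
    have hne : ∀ x ∈ Set.Icc (0 : ℝ) 1, 1 + x ≠ 0 := fun x hx => by linarith [hx.1]
    exact (((continuousOn_const.add continuousOn_id).log hne).pow m).div (by fun_prop) hne
  refine ((intervalIntegrable_log_one_sub_pow k).mul_continuousOn h).congr ?_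
  exact fun t _ => (mul_div_assoc _ _ _).symm

lemma logIntegral_eq_integral_zero_half (k m : ℕ) :
    logIntegral k m = ∫ u in (0 : ℝ)..(1 / 2),
      (Real.log u + Real.log 2) ^ k * (Real.log (1 - u) + Real.log 2) ^ m / (1 - u) := by
  have h := intervalIntegral.integral_comp_sub_mul (a := 0) (b := 1 / 2) (logIntegrand k m)
    (two_ne_zero : (2 : ℝ) ≠ 0) 1
  rw [show (1 : ℝ) - 2 * (1 / 2) = 0 by norm_num, mul_zero, sub_zero, smul_eq_mul] at h
  rw [logIntegral, ← mul_right_inj' (by norm_num : (2⁻¹ : ℝ) ≠ 0), ← h,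
    ← intervalIntegral.integral_const_mul]
  -- The open interval matters: with `Real.log 0 = 0`, the rule log(2u) = log u + log 2 fails at u =
  -- 0.
  refine intervalIntegral.integral_congr_Ioo_of_le (by norm_num) fun u hu => ?_
  have hu0 : u ≠ 0 := hu.1.ne'
  have hu1 : 1 - u ≠ 0 := by linarith [hu.2]
  simp only [logIntegrand]
  rw [← Real.log_mul hu0 two_ne_zero, ← Real.log_mul hu1 two_ne_zero,
    show 1 - (1 - 2 * u) = u * 2 by ring, show 1 + (1 - 2 * u) = (1 - u) * 2 by ring]
  field_simp

lemma logIntegral_eq_integral_half_one (k m : ℕ) :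
    logIntegral k m = ∫ v in (1 / 2 : ℝ)..1,
      (Real.log (1 - v) + Real.log 2) ^ k * (Real.log v + Real.log 2) ^ m / v := by
  rw [logIntegral_eq_integral_zero_half]
  have h := intervalIntegral.integral_comp_sub_left (a := 1 / 2) (b := 1) (fun u : ℝ =>
    (Real.log u + Real.log 2) ^ k * (Real.log (1 - u) + Real.log 2) ^ m / (1 - u)) 1
  rw [sub_self, show (1 : ℝ) - 1 / 2 = 1 / 2 by norm_num] at h
  simp only [sub_sub_cancel] at h
  exact h.symm

/-! ### Iterated primitives along `1 / (1 + y)` -/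

/-- The combination of `G 0, …, G M` with coefficients `log (1 + y) ^ i / i!` whose derivative
telescopes when each `G (a + 1)` is a primitive of `-G a / (1 + y)`. -/
def logOnePlusSum (G : ℕ → ℝ → ℝ) (M : ℕ) (y : ℝ) : ℝ :=
  ∑ i ∈ Finset.range (M + 1), Real.log (1 + y) ^ i / (i.factorial : ℝ) * G (M - i) y

lemma logOnePlusSum_succ (G : ℕ → ℝ → ℝ) (M : ℕ) (y : ℝ) :
    logOnePlusSum G (M + 1) y = logOnePlusSum (fun a => G (a + 1)) M y +
      Real.log (1 + y) ^ (M + 1) / ((M + 1).factorial : ℝ) * G 0 y := by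
  rw [logOnePlusSum, Finset.sum_range_succ, Nat.sub_self, logOnePlusSum]
  congr 1
  refine Finset.sum_congr rfl fun i hi => ?_
  rw [Nat.sub_add_comm (by have := Finset.mem_range.1 hi; omega)]

/-- By induction applied to the shifted family, whose constant is `G 0 y`: its derivative cancels
against the one that falls on log^(M+1)(1+y), leaving only the term with (G 0)'. -/
lemma hasDerivAt_logOnePlusSum {G : ℕ → ℝ → ℝ} {c y : ℝ} (hy : 1 + y ≠ 0)
    (h0 : HasDerivAt (G 0) (-c / (1 + y)) y)
    (hG : ∀ a, HasDerivAt (G (a + 1)) (-G a y / (1 + y)) y) (M : ℕ) :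
    HasDerivAt (logOnePlusSum G M)
      (-(Real.log (1 + y) ^ M / (M.factorial : ℝ) * c / (1 + y))) y := by
  induction M generalizing G c with
  | zero =>
    have : logOnePlusSum G 0 = G 0 := by funext y; simp [logOnePlusSum]
    simpa [this, neg_div] using h0
  | succ M ih =>
    have hl : HasDerivAt (fun y => Real.log (1 + y)) (1 / (1 + y)) y :=
      ((hasDerivAt_id y).const_add 1).log hy
    have h := (ih (G := fun a => G (a + 1)) (hG 0) fun a => hG (a + 1)).add
      (((hl.pow (M + 1)).div_const ((M + 1).factorial : ℝ)).mul h0)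
    convert! h using 1
    · funext y
      exact logOnePlusSum_succ G M y
    · have : (M.factorial : ℝ) ≠ 0 := by positivity
      rw [Nat.factorial_succ]
      simp only [Nat.add_sub_cancel, Pi.pow_apply]
      push_cast
      field_simp
      ring

lemma polylogSeries_neg_one (S : List ℤ) (x : ℝ) :
    polylogSeries (-1) S x = polylogSeries 1 S (-x) := by
  refine tsum_congr fun n => ?_
  rw [polylogCoeff_neg_one, neg_pow x]
  ring

lemma hasDerivAt_polylogSeries_neg_one_cons {s : ℤ} {S : List ℤ} (hs : s ≠ 0)
    (hS : ∀ t ∈ S, t ≠ 0) {y : ℝ} (hy : |y| < 1) :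
    HasDerivAt (polylogSeries (-1) (s :: S)) (-polylogSeries s S (-y) / (1 + y)) y := by
  have h := (hasDerivAt_polylogSeries_one_cons hs hS (x := -y) (by rwa [abs_neg])).comp y
    (hasDerivAt_neg y)
  convert! h using 1
  · funext z
    exact polylogSeries_neg_one _ z
  · rw [sub_neg_eq_add]; ring

lemma barTail_ne_zero (a b : ℕ) :
    ∀ t ∈ List.replicate a (1 : ℤ) ++ -1 :: List.replicate b 1, t ≠ 0 := by
  intro t ht
  rcases List.mem_append.1 ht with h | h
  · exact replicate_one_ne_zero a t h
  · rcases List.mem_cons.1 h with rfl | h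
    · norm_num
    · exact replicate_one_ne_zero b t h

lemma tendsto_multHarmonic_barOneBarOne (a b : ℕ) :
    Tendsto (multHarmonic (barOneBarOne a b)) atTop (𝓝 (mzv (barOneBarOne a b))) := by
  cases a with
  | zero => exact tendsto_multHarmonic_neg_one (by norm_num) (replicate_one_ne_zero b)
  | succ a => exact tendsto_multHarmonic_neg_one one_ne_zero (barTail_ne_zero a b)

/-- The recurrence with all zeta values on one side. `logOnePlusSum` vanishes at 0 and tends to the
left side at 1, so the left side is the integral of its derivative. -/
lemma sum_log_two_pow_mul_mzv_barOneBarOne (M b : ℕ) :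
    ∑ i ∈ Finset.range (M + 1),
        Real.log 2 ^ i / (i.factorial : ℝ) * mzv (barOneBarOne (M - i) b) =
      (-1) ^ b / (((b + 1).factorial : ℝ) * (M.factorial : ℝ)) * logIntegral (b + 1) M := by
  set G : ℕ → ℝ → ℝ :=
    fun a => polylogSeries (-1) (List.replicate a 1 ++ -1 :: List.replicate b 1) with hGdef
  have hb : ((b + 1).factorial : ℝ) ≠ 0 := by positivity
  have hM : (M.factorial : ℝ) ≠ 0 := by positivity
  have hderiv : ∀ y : ℝ, |y| < 1 → HasDerivAt (logOnePlusSum G M)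
      ((-1) ^ b / (((b + 1).factorial : ℝ) * (M.factorial : ℝ)) * logIntegrand (b + 1) M y) y := by
    intro y hy
    have hy1 : 1 + y ≠ 0 := by linarith [(abs_lt.1 hy).1]
    have h0 : HasDerivAt (G 0)
        (-((-Real.log (1 - y)) ^ (b + 1) / ((b + 1).factorial : ℝ)) / (1 + y)) y := by
      have h := hasDerivAt_polylogSeries_neg_one_cons (s := -1) (by norm_num)
        (replicate_one_ne_zero b) hy
      rwa [polylogSeries_neg_one, neg_neg, polylogSeries_one_replicate b hy] at h
    have hG : ∀ a, HasDerivAt (G (a + 1)) (-G a y / (1 + y)) y := by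
      intro a
      have h := hasDerivAt_polylogSeries_neg_one_cons one_ne_zero (barTail_ne_zero a b) hy
      rwa [← polylogSeries_neg_one] at h
    convert hasDerivAt_logOnePlusSum hy1 h0 hG M using 1
    rw [logIntegrand, neg_pow (Real.log (1 - y)), pow_succ (-1 : ℝ) b]
    field_simp
  have hzero : logOnePlusSum G M 0 = 0 := by
    refine Finset.sum_eq_zero fun i _ => ?_
    rw [show G (M - i) 0 = 0 from polylogSeries_zero (by norm_num) _, mul_zero]
  have hl : Tendsto (fun y : ℝ => Real.log (1 + y)) (𝓝[<] 1) (𝓝 (Real.log 2)) := by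
    have : ContinuousAt (fun y : ℝ => Real.log (1 + y)) 1 :=
      ContinuousAt.log (by fun_prop) (by norm_num)
    have h := this.tendsto.mono_left (nhdsWithin_le_nhds (s := Set.Iio 1))
    rwa [one_add_one_eq_two] at h
  have hone : Tendsto (logOnePlusSum G M) (𝓝[<] 1) (𝓝 (∑ i ∈ Finset.range (M + 1),
      Real.log 2 ^ i / (i.factorial : ℝ) * mzv (barOneBarOne (M - i) b))) :=
    tendsto_finsetSum _ fun i _ => ((hl.pow i).div_const _).mul
      (tendsto_polylogSeries_one (by norm_num) (tendsto_multHarmonic_barOneBarOne (M - i) b))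
  have h := intervalIntegral.integral_eq_sub_of_hasDerivAt_of_tendsto one_pos
    (fun y hy => hderiv y (abs_lt.2 ⟨by linarith [hy.1], hy.2⟩))
    ((intervalIntegrable_logIntegrand (b + 1) M).const_mul _)
    ((hderiv 0 (by simp)).continuousAt.tendsto.mono_left nhdsWithin_le_nhds) hone
  rw [intervalIntegral.integral_const_mul, hzero, sub_zero] at h
  exact h.symm

/-! ### The two evaluations of `J(k, m)` -/

lemma polylogSeries_half_eq_multPolylog (l b : ℕ) :
    polylogSeries ((l + 1 : ℕ) : ℤ) (List.replicate b 1) (1 / 2) =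
      multPolylog (consOnes (l + 1) b) (1 / 2) :=
  (multPolylog_eq_polylogSeries (by omega) (replicate_one_ne_zero b)
    (by rw [abs_of_nonneg] <;> norm_num)).symm

/-- At 1/2 the logarithm is -log 2, and the signs (-1)^l and (-1)^(i-l) merge into (-1)^i. The cases
p = 0 and p = 1 serve the two half intervals. -/
lemma logPrimitive_half (p b i : ℕ) :
    logPrimitive (fun l => polylogSeries ((l + (p + 1) : ℕ) : ℤ) (List.replicate b 1)) i (1 / 2) =
      (-1) ^ i * ∑ l ∈ Finset.range (i + 1), (l.factorial : ℝ) * (i.choose l : ℝ) *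
        Real.log 2 ^ (i - l) * multPolylog (consOnes (l + (p + 1)) b) (1 / 2) := by
  rw [logPrimitive, Finset.mul_sum]
  refine Finset.sum_congr rfl fun l hl => ?_
  have hli : l ≤ i := by have := Finset.mem_range.1 hl; omega
  rw [← add_assoc, polylogSeries_half_eq_multPolylog, Nat.descFactorial_eq_factorial_mul_choose, one_div,
    Real.log_inv, neg_pow (Real.log 2)]
  have : (-1 : ℝ) ^ i = (-1) ^ l * (-1) ^ (i - l) := by rw [← pow_add, Nat.add_sub_cancel' hli]
  rw [this]
  push_cast
  ring

lemma integral_log_add_pow_div (m : ℕ) (L : ℝ) (hL : L = Real.log 2) :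
    ∫ v in (1 / 2 : ℝ)..1, (Real.log v + L) ^ m / v = L ^ (m + 1) / (m + 1) := by
  have hd : ∀ v ∈ Set.uIcc (1 / 2 : ℝ) 1, HasDerivAt
      (fun v => (Real.log v + L) ^ (m + 1) / ((m : ℝ) + 1)) ((Real.log v + L) ^ m / v) v := by
    intro v hv
    rw [Set.uIcc_of_le (by norm_num)] at hv
    have hv0 : v ≠ 0 := by linarith [hv.1]
    convert! (((Real.hasDerivAt_log hv0).add_const L).pow (m + 1)).div_const ((m : ℝ) + 1) using 1
    have : (m : ℝ) + 1 ≠ 0 := by positivity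
    push_cast
    field_simp
  have hc : ContinuousOn (fun v : ℝ => (Real.log v + L) ^ m / v) (Set.uIcc (1 / 2) 1) := by
    rw [Set.uIcc_of_le (by norm_num)]
    have hne : ∀ x ∈ Set.Icc (1 / 2 : ℝ) 1, x ≠ 0 := fun x hx => by linarith [hx.1]
    exact (((continuousOn_id.log hne).add continuousOn_const).pow m).div continuousOn_id hne
  rw [intervalIntegral.integral_eq_sub_of_hasDerivAt hd hc.intervalIntegrable]
  -- The lower limit contributes 0 because log(1/2) + log 2 = 0.
  simp [hL]

theorem logIntegral_eq_sum_zero_half (k m : ℕ) :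
    logIntegral k m = ∑ i ∈ Finset.range (k + 1), ∑ j ∈ Finset.range (m + 1),
      Real.log 2 ^ (k - i) * (k.choose i : ℝ) * (Real.log 2 ^ (m - j) * (m.choose j : ℝ)) *
        ∫ u in (0 : ℝ)..(1 / 2), Real.log u ^ i * (Real.log (1 - u) ^ j / (1 - u)) := by
  have hint : ∀ i j, IntervalIntegrable (fun u : ℝ =>
      Real.log 2 ^ (k - i) * (k.choose i : ℝ) * (Real.log 2 ^ (m - j) * (m.choose j : ℝ)) *
        (Real.log u ^ i * (Real.log (1 - u) ^ j / (1 - u)))) MeasureTheory.volume 0 (1 / 2) :=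
    fun i j => (intervalIntegrable_log_pow_mul_log_one_sub_pow i j).const_mul _
  simp_rw [← intervalIntegral.integral_const_mul]
  have h1 : ∀ i, ∑ j ∈ Finset.range (m + 1), ∫ u in (0 : ℝ)..(1 / 2),
      Real.log 2 ^ (k - i) * (k.choose i : ℝ) * (Real.log 2 ^ (m - j) * (m.choose j : ℝ)) *
        (Real.log u ^ i * (Real.log (1 - u) ^ j / (1 - u))) = _ :=
    fun i => (intervalIntegral.integral_finsetSum fun j _ => hint i j).symm
  simp_rw [h1]
  rw [← intervalIntegral.integral_finsetSum fun i _ =>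
    (by simpa only [Finset.sum_fn] using IntervalIntegrable.sum _ fun j _ => hint i j),
    logIntegral_eq_integral_zero_half]
  congr 1
  funext u
  rw [add_pow, add_pow, Finset.sum_mul_sum, Finset.sum_div]
  refine Finset.sum_congr rfl fun i _ => ?_
  rw [Finset.sum_div]
  exact Finset.sum_congr rfl fun j _ => by ring

theorem logIntegral_eq_sum_half_one (k m : ℕ) :
    logIntegral k m = ∑ i ∈ Finset.range (k + 1), ∑ j ∈ Finset.range (m + 1),
      Real.log 2 ^ (k - i) * (k.choose i : ℝ) * (Real.log 2 ^ (m - j) * (m.choose j : ℝ)) *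
        ∫ v in (1 / 2 : ℝ)..1, Real.log (1 - v) ^ i * (Real.log v ^ j / v) := by
  have hint : ∀ i j, IntervalIntegrable (fun v : ℝ =>
      Real.log 2 ^ (k - i) * (k.choose i : ℝ) * (Real.log 2 ^ (m - j) * (m.choose j : ℝ)) *
        (Real.log (1 - v) ^ i * (Real.log v ^ j / v))) MeasureTheory.volume (1 / 2) 1 :=
    fun i j => (intervalIntegrable_log_one_sub_pow_mul_log_pow i j).const_mul _
  simp_rw [← intervalIntegral.integral_const_mul]
  have h1 : ∀ i, ∑ j ∈ Finset.range (m + 1), ∫ v in (1 / 2 : ℝ)..1,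
      Real.log 2 ^ (k - i) * (k.choose i : ℝ) * (Real.log 2 ^ (m - j) * (m.choose j : ℝ)) *
        (Real.log (1 - v) ^ i * (Real.log v ^ j / v)) = _ :=
    fun i => (intervalIntegral.integral_finsetSum fun j _ => hint i j).symm
  simp_rw [h1]
  rw [← intervalIntegral.integral_finsetSum fun i _ =>
    (by simpa only [Finset.sum_fn] using IntervalIntegrable.sum _ fun j _ => hint i j),
    logIntegral_eq_integral_half_one]
  congr 1
  funext v
  rw [add_pow, add_pow, Finset.sum_mul_sum, Finset.sum_div]
  refine Finset.sum_congr rfl fun i _ => ?_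
  rw [Finset.sum_div]
  exact Finset.sum_congr rfl fun j _ => by ring

/-- The i = 0 part of the expansion over (1/2,1): undoing the binomial expansion makes it
elementary, and it yields the pure power of log 2. -/
lemma sum_choose_mul_integral_log_pow_div (m : ℕ) :
    ∑ j ∈ Finset.range (m + 1), Real.log 2 ^ (m - j) * (m.choose j : ℝ) *
        ∫ v in (1 / 2 : ℝ)..1, Real.log v ^ j / v =
      Real.log 2 ^ (m + 1) / (m + 1) := by
  rw [← integral_log_add_pow_div m _ rfl]
  simp_rw [← intervalIntegral.integral_const_mul]
  rw [← intervalIntegral.integral_finsetSum fun j _ => (by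
    simpa using (intervalIntegrable_log_one_sub_pow_mul_log_pow 0 j).const_mul
      (Real.log 2 ^ (m - j) * (m.choose j : ℝ)))]
  congr 1
  funext v
  rw [add_pow, Finset.sum_div]
  exact Finset.sum_congr rfl fun j _ => by ring

theorem logIntegral_first_evaluation (k m : ℕ) :
    logIntegral k m =
        1 / ((m : ℝ) + 1) * Real.log 2 ^ (m + k + 1)
        + ∑ i ∈ Finset.Icc 1 k, ∑ j ∈ Finset.Icc 0 m,
            (-1 : ℝ) ^ (i + j) * (i.factorial : ℝ) * (j.factorial : ℝ)
              * Real.log 2 ^ (m + k - i - j) * (k.choose i : ℝ) * (m.choose j : ℝ)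
              * mzv (consOnes (j + 2) (i - 1))
        - ∑ i ∈ Finset.Icc 1 k, ∑ j ∈ Finset.Icc 0 m, ∑ l ∈ Finset.Icc 0 j,
            (-1 : ℝ) ^ (i + j) * (i.factorial : ℝ) * (l.factorial : ℝ)
              * Real.log 2 ^ (m + k - i - l) * (k.choose i : ℝ) * (m.choose j : ℝ)
              * (j.choose l : ℝ) * multPolylog (consOnes (l + 2) (i - 1)) (1 / 2) := by
  -- The i = 0 row is split off; the rows i = b + 1 give zeta values minus values at 1/2.
  rw [logIntegral_eq_sum_half_one, sum_range_succ_eq_add_sum_Icc, add_sub_assoc,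
    ← Finset.sum_sub_distrib]
  congr 1
  · have h := sum_choose_mul_integral_log_pow_div m
    simp only [pow_zero, one_mul, Nat.choose_zero_right, Nat.cast_one, mul_one, Nat.sub_zero,
      mul_assoc, ← Finset.mul_sum] at h ⊢
    rw [h, add_right_comm, pow_add _ (m + 1) k]
    ring
  · refine Finset.sum_congr rfl fun i hi => ?_
    obtain ⟨hi1, hik⟩ := Finset.mem_Icc.1 hi
    obtain ⟨b, rfl⟩ : ∃ b, i = b + 1 := ⟨i - 1, by omega⟩
    simp only [← Nat.range_succ_eq_Icc_zero, Nat.add_sub_cancel]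
    rw [← Finset.sum_sub_distrib]
    refine Finset.sum_congr rfl fun j hj => ?_
    have hjm : j ≤ m := by have := Finset.mem_range.1 hj; omega
    rw [integral_log_one_sub_pow_mul_log_pow, logPrimitive_half 1, mul_sub, mul_sub]
    congr 1
    -- No natural-number subtraction truncates here, since b + 1 ≤ k and j ≤ m.
    · rw [show m + k - (b + 1) - j = (k - (b + 1)) + (m - j) by omega]
      ring
    · simp only [Finset.mul_sum]
      refine Finset.sum_congr rfl fun l hl => ?_
      have hlj : l ≤ j := by have := Finset.mem_range.1 hl; omega
      rw [show m + k - (b + 1) - l = (k - (b + 1)) + (m - j) + (j - l) by omega]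
      ring

theorem logIntegral_second_evaluation (k m : ℕ) :
    logIntegral k m =
        ∑ i ∈ Finset.Icc 0 k, ∑ j ∈ Finset.Icc 0 m, ∑ l ∈ Finset.Icc 0 i,
          (-1 : ℝ) ^ (i + j) * (j.factorial : ℝ) * (l.factorial : ℝ)
            * Real.log 2 ^ (m + k - j - l) * (k.choose i : ℝ) * (i.choose l : ℝ)
            * (m.choose j : ℝ) * multPolylog (consOnes (l + 1) j) (1 / 2) := by
  rw [logIntegral_eq_sum_zero_half]
  simp only [← Nat.range_succ_eq_Icc_zero]
  refine Finset.sum_congr rfl fun i hi => Finset.sum_congr rfl fun j hj => ?_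
  have hik : i ≤ k := by have := Finset.mem_range.1 hi; omega
  have hjm : j ≤ m := by have := Finset.mem_range.1 hj; omega
  rw [integral_log_pow_mul_log_one_sub_pow, logPrimitive_half 0]
  simp only [Finset.mul_sum]
  refine Finset.sum_congr rfl fun l hl => ?_
  have hli : l ≤ i := by have := Finset.mem_range.1 hl; omega
  rw [show m + k - j - l = (k - i) + (m - j) + (i - l) by omega]
  ring

end

theorem theorem2p2 :
    -- convergence of the series and integrals that occur
    (∀ a b : ℕ, Tendsto (multHarmonic (barOneBarOne a b)) atTop (𝓝 (mzv (barOneBarOne a b)))) ∧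
    (∀ p a : ℕ, 2 ≤ p → Tendsto (multHarmonic (consOnes p a)) atTop (𝓝 (mzv (consOnes p a)))) ∧
    (∀ p a : ℕ, 1 ≤ p → Tendsto (multPolylogPartial (1 / 2) (consOnes p a)) atTop
      (𝓝 (multPolylog (consOnes p a) (1 / 2)))) ∧
    (∀ k m : ℕ, 1 ≤ k → IntervalIntegrable (logIntegrand k m) MeasureTheory.volume 0 1) ∧
    -- the recurrence
    (∀ m k : ℕ, 1 ≤ m → 1 ≤ k →
      mzv (barOneBarOne (m - 1) (k - 1)) =
        (-1 : ℝ) ^ (k - 1) / ((k.factorial : ℝ) * ((m - 1).factorial : ℝ)) * logIntegral k (m - 1)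
        - ∑ i ∈ Finset.Icc 1 (m - 1), Real.log 2 ^ i / (i.factorial : ℝ)
            * mzv (barOneBarOne (m - 1 - i) (k - 1))) ∧
    -- the first evaluation of the integral
    (∀ k m : ℕ, 1 ≤ k →
      logIntegral k m =
        1 / ((m : ℝ) + 1) * Real.log 2 ^ (m + k + 1)
        + ∑ i ∈ Finset.Icc 1 k, ∑ j ∈ Finset.Icc 0 m,
            (-1 : ℝ) ^ (i + j) * (i.factorial : ℝ) * (j.factorial : ℝ)
              * Real.log 2 ^ (m + k - i - j) * (k.choose i : ℝ) * (m.choose j : ℝ)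
              * mzv (consOnes (j + 2) (i - 1))
        - ∑ i ∈ Finset.Icc 1 k, ∑ j ∈ Finset.Icc 0 m, ∑ l ∈ Finset.Icc 0 j,
            (-1 : ℝ) ^ (i + j) * (i.factorial : ℝ) * (l.factorial : ℝ)
              * Real.log 2 ^ (m + k - i - l) * (k.choose i : ℝ) * (m.choose j : ℝ)
              * (j.choose l : ℝ) * multPolylog (consOnes (l + 2) (i - 1)) (1 / 2)) ∧
    -- the second evaluation of the integral
    (∀ k m : ℕ, 1 ≤ k →
      logIntegral k m =
        ∑ i ∈ Finset.Icc 0 k, ∑ j ∈ Finset.Icc 0 m, ∑ l ∈ Finset.Icc 0 i,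
          (-1 : ℝ) ^ (i + j) * (j.factorial : ℝ) * (l.factorial : ℝ)
            * Real.log 2 ^ (m + k - j - l) * (k.choose i : ℝ) * (i.choose l : ℝ)
            * (m.choose j : ℝ) * multPolylog (consOnes (l + 1) j) (1 / 2)) := by
  refine ⟨tendsto_multHarmonic_barOneBarOne,
    fun p a hp => tendsto_multHarmonic_of_two_le (by omega) (replicate_one_ne_zero a),
    fun p a hp => ?_, fun k m _ => intervalIntegrable_logIntegrand k m, fun m k hm hk => ?_,
    fun k m _ => logIntegral_first_evaluation k m, fun k m _ => logIntegral_second_evaluation k m⟩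
  · have hp0 : (p : ℤ) ≠ 0 := by omega
    have hx : |(1 / 2 : ℝ)| < 1 := by rw [abs_of_nonneg] <;> norm_num
    rw [consOnes, multPolylog_eq_polylogSeries hp0 (replicate_one_ne_zero a) hx]
    exact tendsto_multPolylogPartial hp0 (replicate_one_ne_zero a) hx
  · obtain ⟨M, rfl⟩ : ∃ M, m = M + 1 := ⟨m - 1, by omega⟩
    obtain ⟨b, rfl⟩ : ∃ b, k = b + 1 := ⟨k - 1, by omega⟩
    have h := sum_log_two_pow_mul_mzv_barOneBarOne M b
    -- The i = 0 term is the zeta value to be isolated.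
    rw [sum_range_succ_eq_add_sum_Icc] at h
    simp only [pow_zero, Nat.factorial_zero, Nat.cast_one, div_one, one_mul, Nat.sub_zero] at h
    simp only [Nat.add_sub_cancel]
    rw [← h, add_sub_cancel_right]
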